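/- **Proposition 4.3 (Lie algebra of $\mathbb X_z^0(\mathbb C)$).** Let $\mathbb X^0(\mathbb C)$ be the space of nonunit formal power series $a_1z+a_2z^2+\cdots$ over $\mathbb C$, and let $G=\mathbb X_z^0(\mathbb C)=\{a_1z+a_2z^2+\cdots\in\mathbb C[[z]] : a_1\neq 0\}$, with composition $(g,f)\mapsto g\circ f$ as product, the topology of coefficientwise convergence, and the manifold structure given by the single global chart $a_1z+a_2z^2+\cdots\mapsto(a_1,a_2,\dots)$, whose image is open in the Fréchet space $\mathbb C^{\mathbb N}$. Smoothness is understood through continuous iterated (complex) directional derivatives, and every tangent space $T_gG=\mathbb C^{\mathbb N}$ is identified with $\mathbb X^0(\mathbb C)$ by $(a_1,a_2,\dots)\leftrightarrow a_1z+a_2z^2+\cdots$. Then $G$ is a Fréchet–Lie group modelled on $\mathbb C^{\mathbb N}$. Its Lie algebra, i.e. the space $L(G)$ of smooth left-invariant vector fields on $G$ with the Lie bracket of vector fields $[V,W](x)=dW(x)(V(x))-dV(x)(W(x))$, can be identified with the Lie algebra $\mathbb X^0(\mathbb C)$ with bracket $$[f,h]=fh'-f'h .$$ More precisely, the smooth left-invariant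 vector fields form a linear subspace $L(G)$ of the space of all vector fields on $G$, and the map that sends $f\in\mathbb X^0(\mathbb C)$ to the vector field $\Phi_f:\ g\mapsto -g'f$ (the left-invariant vector field with value $-f$ at the identity $z$) is a linear isomorphism of $\mathbb X^0(\mathbb C)$ onto $L(G)$ satisfying $\Phi_{[f,h]}=[\Phi_f,\Phi_h]$ for all $f,h\in\mathbb X^0(\mathbb C)$. -/

import Mathlib

open Filter Topology PowerSeries
open scoped PowerSeries.WithPiTopology Manifold

noncomputable section

universe u v w

/-! ### Calculus in (complex) topological vector spaces -/

section Calculus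

/-- `f` has derivative `y` at `x` in the direction `h`: `(f (x + t h) - f x) / t → y` as
`t → 0`, `t ≠ 0`, `t` complex. -/
def HasDirDeriv {E : Type u} {F : Type v} [AddCommGroup E] [Module ℂ E]
    [AddCommGroup F] [Module ℂ F] [TopologicalSpace F]
    (f : E → F) (x h : E) (y : F) : Prop :=
  Tendsto (fun t : ℂ => t⁻¹ • (f (x + t • h) - f x)) (𝓝[≠] 0) (𝓝 y)

/-- The derivative `df(x)(h)` of `f` at `x` in the direction `h` (only meaningful if it exists,
see `HasDirDeriv`). -/
def dirDeriv {E : Type u} {F : Type v} [AddCommGroup E] [Module ℂ E]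
    [AddCommGroup F] [Module ℂ F] [TopologicalSpace F]
    (f : E → F) (x h : E) : F :=
  limUnder (𝓝[≠] (0 : ℂ)) (fun t : ℂ => t⁻¹ • (f (x + t • h) - f x))

/-- `C^n` maps on an open subset `U` of a topological vector space: `f` is `C^0` on `U` if it is
continuous there, and `C^(n+1)` if it is continuous, all directional derivatives at points of `U`
exist, and `(x, h) ↦ df(x)(h)` is `C^n` on `U × E`. -/
def IsCnOn : ℕ → ∀ {E : Type u} {F : Type v} [AddCommGroup E] [Module ℂ E] [TopologicalSpace E]
    [AddCommGroup F] [Module ℂ F] [TopologicalSpace F], (E → F) → Set E → Prop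
  | 0, _, _, _, _, _, _, _, _, f, U => ContinuousOn f U
  | n + 1, E, F, _, _, _, _, _, _, f, U => ContinuousOn f U ∧ ∃ df : E × E → F,
      (∀ x ∈ U, ∀ h : E, HasDirDeriv f x h (df (x, h))) ∧ IsCnOn n df (U ×ˢ Set.univ)

/-- Smooth (`C^∞`) maps on an open subset `U` of a topological vector space. -/
def IsSmoothOn {E : Type u} {F : Type v} [AddCommGroup E] [Module ℂ E] [TopologicalSpace E]
    [AddCommGroup F] [Module ℂ F] [TopologicalSpace F] (f : E → F) (U : Set E) : Prop :=
  ∀ n : ℕ, IsCnOn n f U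

/-- Complex Fréchet spaces: Hausdorff, complete, with topology given by countably many seminorms. -/
structure IsFrechetSpace (E : Type u) [AddCommGroup E] [Module ℂ E] [UniformSpace E] : Prop where
  isUniformAddGroup : IsUniformAddGroup E
  t2Space : T2Space E
  completeSpace : CompleteSpace E
  exists_seminorms : ∃ p : SeminormFamily ℂ E ℕ, WithSeminorms p

end Calculus

/-! ### Manifolds modelled on a topological vector space `E`

The tangent space at a point `x` is `E`, a tangent vector being represented by its coordinates in
the preferred chart `chartAt E x`. -/

section Manifold

variable (E : Type u) [AddCommGroup E] [Module ℂ E] [TopologicalSpace E]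
  (F : Type v) [AddCommGroup F] [Module ℂ F] [TopologicalSpace F]

/-- Hausdorff smooth manifolds modelled on `E`: all transition maps are smooth. -/
structure IsSmoothManifold (M : Type w) [TopologicalSpace M] [ChartedSpace E M] : Prop where
  t2Space : T2Space M
  smooth_transition : ∀ e ∈ atlas E M, ∀ e' ∈ atlas E M,
    IsSmoothOn (fun u : E => e' (e.symm u)) (e.symm ≫ₕ e').source

/-- Smooth maps between manifolds: continuous, and smooth in charts. -/
def IsSmoothMap {M : Type*} {N : Type*} [TopologicalSpace M] [ChartedSpace E M]
    [TopologicalSpace N] [ChartedSpace F N] (f : M → N) : Prop :=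
  Continuous f ∧ ∀ e ∈ atlas E M, ∀ e' ∈ atlas F N,
    IsSmoothOn (fun u : E => e' (f (e.symm u)))
      (e.target ∩ e.symm ⁻¹' (f ⁻¹' e'.source))

/-- The product manifold structure, modelled on `E × F`. -/
instance prodChartedSpaceTVS (M : Type*) (N : Type*) [TopologicalSpace M] [ChartedSpace E M]
    [TopologicalSpace N] [ChartedSpace F N] : ChartedSpace (E × F) (M × N) :=
  prodChartedSpace E M F N

variable {F} in
/-- The tangent map `df_x : T_x M → T_{f x} N`. -/
def tangentMapAt {M : Type*} {N : Type*} [TopologicalSpace M] [ChartedSpace E M]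
    [TopologicalSpace N] [ChartedSpace F N] (f : M → N) (x : M) (v : E) : F :=
  dirDeriv (fun u : E => chartAt F (f x) (f ((chartAt E x).symm u))) (chartAt E x x) v

variable {E} in
/-- The coordinate representation, in the chart `e`, of a vector field `V`. -/
def localRep {M : Type*} [TopologicalSpace M] [ChartedSpace E M]
    (e : OpenPartialHomeomorph M E) (V : M → E) (u : E) : E :=
  dirDeriv (fun v : E => e ((chartAt E (e.symm u)).symm v))
    (chartAt E (e.symm u) (e.symm u)) (V (e.symm u))

variable {E} in
/-- Smooth vector fields: smooth in all charts. -/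
def IsSmoothVectorField {M : Type*} [TopologicalSpace M] [ChartedSpace E M] (V : M → E) : Prop :=
  ∀ e ∈ atlas E M, IsSmoothOn (localRep e V) e.target

variable {E} in
/-- The Lie bracket of vector fields, in local coordinates
`[V, W](x) = dW(x)(V(x)) - dV(x)(W(x))`. -/
def vectorFieldBracket {M : Type*} [TopologicalSpace M] [ChartedSpace E M] (V W : M → E) :
    M → E := fun x =>
  dirDeriv (localRep (chartAt E x) W) (chartAt E x x) (V x) -
    dirDeriv (localRep (chartAt E x) V) (chartAt E x x) (W x)

end Manifold

/-! ### Fréchet-Lie groups and their Lie algebras -/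

section LieGroup

/-- Fréchet-Lie groups modelled on the Fréchet space `E`. -/
structure IsFrechetLieGroup (E : Type u) [AddCommGroup E] [Module ℂ E] [UniformSpace E]
    (G : Type w) [Group G] [TopologicalSpace G] [ChartedSpace E G] : Prop where
  isFrechetSpace : IsFrechetSpace E
  isSmoothManifold : IsSmoothManifold E G
  smooth_mul : IsSmoothMap (E × E) E (fun p : G × G => p.1 * p.2)
  smooth_inv : IsSmoothMap E E (fun g : G => g⁻¹)

/-- Elements of the Lie algebra of the Lie group `G`: smooth vector fields `V` on `G` which are
left invariant, i.e. `dλ_g (V x) = V (g x)`, where `λ_g` is left translation by `g`. The Lie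
bracket is `vectorFieldBracket`. -/
structure IsLeftInvariantVectorField {E : Type u} [AddCommGroup E] [Module ℂ E]
    [TopologicalSpace E] {G : Type w} [Group G] [TopologicalSpace G] [ChartedSpace E G]
    (V : G → E) : Prop where
  smooth : IsSmoothVectorField V
  left_invariant : ∀ g x : G, tangentMapAt E (fun y : G => g * y) x (V x) = V (g * x)

end LieGroup

/-! ### The group of formal power series `a₁ z + a₂ z² + ⋯`, `a₁ ≠ 0`, under composition -/

section InvertibleSeries

/-- Formal power series `a₁ z + a₂ z² + ⋯` with `a₁ ≠ 0`. -/
@[ext]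
structure InvertibleSeries where
  series : ℂ⟦X⟧
  constantCoeff_series : constantCoeff series = 0
  coeff_one_series : coeff 1 series ≠ 0

namespace InvertibleSeries

/-- The topology of coefficientwise convergence (as a subspace of `ℂ⟦X⟧`). -/
instance : TopologicalSpace InvertibleSeries :=
  TopologicalSpace.induced series inferInstance

lemma hasSubst (f : InvertibleSeries) : HasSubst f.series :=
  HasSubst.of_constantCoeff_zero' f.constantCoeff_series

lemma coeff_one_comp (g f : InvertibleSeries) :
    coeff 1 (g.series.subst f.series) = coeff 1 g.series * coeff 1 f.series := by
  rw [coeff_subst' f.hasSubst, finsum_eq_single _ 1]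
  · simp
  · rintro (_ | _ | n) hn
    · simp [coeff_one]
    · simp at hn
    · have h2 : (X : ℂ⟦X⟧) ^ (n + 2) ∣ f.series ^ (n + 2) :=
        pow_dvd_pow_of_dvd (X_dvd_iff.2 f.constantCoeff_series) _
      rw [X_pow_dvd_iff.1 h2 1 (by omega), smul_zero]

/-- The product is composition: `g * f = g ∘ f`. -/
instance : Mul InvertibleSeries where
  mul g f := ⟨g.series.subst f.series,
    PowerSeries.constantCoeff_subst_eq_zero f.constantCoeff_series g.series g.constantCoeff_series,
    by rw [coeff_one_comp]; exact mul_ne_zero g.coeff_one_series f.coeff_one_series⟩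

/-- The identity is the series `z`. -/
instance : One InvertibleSeries where
  one := ⟨X, by simp, by simp⟩

/-- The inverse is the composition inverse. -/
instance : Inv InvertibleSeries where
  inv f :=
    letI : Invertible (coeff 1 f.series) := invertibleOfNonzero f.coeff_one_series
    ⟨substInv f.series, constantCoeff_substInv f.series, by
      rw [coeff_one_substInv, invOf_eq_inv]; exact inv_ne_zero f.coeff_one_series⟩

instance : Group InvertibleSeries where
  mul_assoc h g f :=
    InvertibleSeries.ext (subst_comp_subst_apply g.hasSubst f.hasSubst h.series)
  one_mul f := InvertibleSeries.ext (subst_X f.hasSubst)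
  mul_one f := InvertibleSeries.ext (X_subst f.series)
  inv_mul_cancel f :=
    letI : Invertible (coeff 1 f.series) := invertibleOfNonzero f.coeff_one_series
    InvertibleSeries.ext (subst_substInv_left f.series f.constantCoeff_series)

/-- The coordinates `(a₁, a₂, …)` of `a₁ z + a₂ z² + ⋯`. -/
def coords (f : InvertibleSeries) : ℕ → ℂ := fun n => coeff (n + 1) f.series

open Classical in
/-- The series `a₁ z + a₂ z² + ⋯` with coordinates `(a₁, a₂, …)`, if `a₁ ≠ 0` (and `z` otherwise). -/
def ofCoords (a : ℕ → ℂ) : InvertibleSeries :=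
  if h : a 0 ≠ 0 then ⟨X * PowerSeries.mk a, by simp, by
    rw [show 1 = 0 + 1 from rfl, coeff_succ_X_mul]; simpa using h⟩ else 1

lemma series_ofCoords {a : ℕ → ℂ} (h : a 0 ≠ 0) :
    (ofCoords a).series = X * PowerSeries.mk a := by
  rw [ofCoords, dif_pos h]

lemma continuous_X_mul_mk : Continuous (fun a : ℕ → ℂ => X * (PowerSeries.mk a : ℂ⟦X⟧)) := by
  refine continuous_iff_continuousAt.2 fun a =>
    (PowerSeries.WithPiTopology.tendsto_iff_coeff_tendsto _ _ _ _).2 fun d => ?_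
  cases d with
  | zero => simp
  | succ n => simpa [coeff_succ_X_mul] using (continuous_apply n).tendsto a

/-- The global chart `a₁ z + a₂ z² + ⋯ ↦ (a₁, a₂, …)`, with open image `{a | a₁ ≠ 0}`. -/
def chart : OpenPartialHomeomorph InvertibleSeries (ℕ → ℂ) where
  toFun := coords
  invFun := ofCoords
  source := Set.univ
  target := {a | a 0 ≠ 0}
  map_source' f _ := f.coeff_one_series
  map_target' _ _ := Set.mem_univ _
  left_inv' f _ := by
    have h : coords f 0 ≠ 0 := f.coeff_one_series
    refine InvertibleSeries.ext (PowerSeries.ext fun n => ?_)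
    rw [series_ofCoords h]
    cases n with
    | zero => simpa using f.constantCoeff_series.symm
    | succ n => simp [coeff_succ_X_mul, coords]
  right_inv' a ha := by
    funext n
    simp [coords, series_ofCoords ha, coeff_succ_X_mul]
  open_source := isOpen_univ
  open_target := isOpen_ne.preimage (continuous_apply 0)
  continuousOn_toFun := (continuous_pi fun n =>
    (PowerSeries.WithPiTopology.continuous_coeff ℂ (n + 1)).comp
      continuous_induced_dom).continuousOn
  continuousOn_invFun := by
    rw [continuousOn_iff_continuous_domRestrict, continuous_induced_rng]
    refine (continuous_X_mul_mk.comp continuous_subtype_val).congr fun a => ?_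
    exact (series_ofCoords a.2).symm

/-- The manifold structure defined by the global chart. -/
instance : ChartedSpace (ℕ → ℂ) InvertibleSeries :=
  chart.singletonChartedSpace rfl

end InvertibleSeries

end InvertibleSeries

/-! ### The Lie algebra of nonunit formal power series -/

section NonunitSeries

/-- The space of nonunit formal power series `a₁ z + a₂ z² + ⋯`. -/
def NonunitSeries : Submodule ℂ ℂ⟦X⟧ := LinearMap.ker (coeff (R := ℂ) 0)

namespace NonunitSeries

lemma constantCoeff_eq_zero (f : NonunitSeries) : constantCoeff (f : ℂ⟦X⟧) = 0 := by
  rw [← coeff_zero_eq_constantCoeff_apply]; exact f.2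

/-- The bracket `[f, g] = f g' - f' g`. -/
instance : Bracket NonunitSeries NonunitSeries where
  bracket f g := ⟨(f : ℂ⟦X⟧) * derivative ℂ (g : ℂ⟦X⟧) - derivative ℂ (f : ℂ⟦X⟧) * (g : ℂ⟦X⟧), by
    simp [NonunitSeries, constantCoeff_eq_zero]⟩

lemma coe_bracket (f g : NonunitSeries) : ((⁅f, g⁆ : NonunitSeries) : ℂ⟦X⟧) =
    (f : ℂ⟦X⟧) * derivative ℂ (g : ℂ⟦X⟧) - derivative ℂ (f : ℂ⟦X⟧) * (g : ℂ⟦X⟧) := rfl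

instance : LieRing NonunitSeries where
  add_lie f g h := Subtype.ext (by simp only [coe_bracket, Submodule.coe_add, map_add]; ring)
  lie_add f g h := Subtype.ext (by simp only [coe_bracket, Submodule.coe_add, map_add]; ring)
  lie_self f := Subtype.ext (by simp only [coe_bracket, Submodule.coe_zero]; ring)
  leibniz_lie f g h := Subtype.ext (by
    simp only [coe_bracket, Submodule.coe_add, map_sub, Derivation.leibniz, smul_eq_mul]; ring)

instance : LieAlgebra ℂ NonunitSeries where
  lie_smul c f g := Subtype.ext (by
    simp only [coe_bracket, Submodule.coe_smul, Derivation.map_smul, mul_smul_comm, smul_sub])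

/-- The identification of the nonunit series with the model space `ℂ^ℕ`, which is the tangent
space of the group of invertible series at each point: `a₁ z + a₂ z² + ⋯ ↦ (a₁, a₂, …)`. -/
def coords : NonunitSeries ≃L[ℂ] (ℕ → ℂ) where
  toFun f := fun n => coeff (n + 1) (f : ℂ⟦X⟧)
  invFun a := ⟨X * PowerSeries.mk a, by simp [NonunitSeries]⟩
  map_add' f g := by funext n; simp
  map_smul' c f := by funext n; simp
  left_inv f := by
    refine Subtype.ext (PowerSeries.ext fun n => ?_)
    cases n with
    | zero => simp [constantCoeff_eq_zero]
    | succ n => simp [coeff_succ_X_mul]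
  right_inv a := by funext n; simp [coeff_succ_X_mul]
  continuous_toFun := continuous_pi fun n =>
    (PowerSeries.WithPiTopology.continuous_coeff ℂ (n + 1)).comp continuous_subtype_val
  continuous_invFun := InvertibleSeries.continuous_X_mul_mk.subtype_mk fun a => by
    simp [NonunitSeries]

/-- The product `g' f`, a nonunit series since `f` is. -/
def derivMul (g : ℂ⟦X⟧) (f : NonunitSeries) : NonunitSeries :=
  ⟨derivative ℂ g * (f : ℂ⟦X⟧), by simp [NonunitSeries, constantCoeff_eq_zero]⟩

end NonunitSeries

end NonunitSeries

end

/-!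
The group law and the inversion of `InvertibleSeries` are rational in the coordinates: each
coefficient of `g ∘ f` is a polynomial in the coefficients of `g` and `f`
(`IsRational.coeff_subst`), and the coefficients of the composition inverse are obtained
recursively, dividing only by powers of the leading coefficient
(`IsRational.coeff_of_subst_eq_X`). The class `IsRational` of functions is stable under
directional differentiation (`IsRational.exists_hasDirDeriv`). Maps into `ℂ^ℕ` with rational
components are therefore smooth (`IsRational.isSmoothOn_pi`), and no general chain rule is needed
for `IsCnOn`.

The tangent map at `x` of the left translation by `g` is multiplication by `g' ∘ x`
(`InvertibleSeries.tangentMapAt_mul_left`). By the chain rule `(g ∘ x)' = (g' ∘ x) x'`, the field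
`Φ_f : g ↦ -g' f` is left invariant. Conversely a left-invariant field `V` is determined by its
value at `z`, through `V g = g' V(z)`. Finally `u ↦ -u' f` is the restriction of a continuous
linear map to the image of the global chart, so that
`[Φ_f, Φ_h](g) = (g' f)' h - (g' h)' f = -g' (f h' - f' h)`, the terms with `g''` cancelling.
-/

noncomputable section

universe u v

/-! ### Directional derivatives -/

section DirectionalDerivatives

variable {E : Type*} [AddCommGroup E] [Module ℂ E]

lemma hasDirDeriv_iff_hasDerivAt {f : E → ℂ} {x h : E} {y : ℂ} :
    HasDirDeriv f x h y ↔ HasDerivAt (fun t : ℂ => f (x + t • h)) y 0 := by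
  simp [HasDirDeriv, hasDerivAt_iff_tendsto_slope_zero]

lemma hasDirDeriv_pi {ι : Type*} {f : E → ι → ℂ} {x h : E} {y : ι → ℂ} :
    HasDirDeriv f x h y ↔ ∀ i, HasDirDeriv (fun u => f u i) x h (y i) := by
  simp [HasDirDeriv, tendsto_pi_nhds]

lemma HasDirDeriv.dirDeriv_eq {F : Type*} [AddCommGroup F] [Module ℂ F] [TopologicalSpace F]
    [T2Space F] {f : E → F} {x h : E} {y : F} (hf : HasDirDeriv f x h y) :
    dirDeriv f x h = y :=
  hf.limUnder_eq

lemma HasDirDeriv.congr_on {F : Type*} [AddCommGroup F] [Module ℂ F] [TopologicalSpace F]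
    [TopologicalSpace E] [ContinuousAdd E] [ContinuousSMul ℂ E] {U : Set E} (hU : IsOpen U)
    {f g : E → F} (hfg : Set.EqOn f g U) {x h : E} (hx : x ∈ U) {y : F}
    (hf : HasDirDeriv f x h y) : HasDirDeriv g x h y := by
  have hc : Continuous fun t : ℂ => x + t • h := by fun_prop
  have hev : ∀ᶠ t : ℂ in 𝓝 0, x + t • h ∈ U :=
    hc.continuousAt.eventually_mem (hU.mem_nhds (by simpa using hx))
  refine Tendsto.congr' ?_ hf
  filter_upwards [nhdsWithin_le_nhds hev] with t ht
  rw [hfg ht, hfg hx]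

/-- The derivative of a continuous linear functional is the functional itself. -/
lemma ContinuousLinearMap.hasDirDeriv [TopologicalSpace E] (φ : E →L[ℂ] ℂ) (x h : E) :
    HasDirDeriv φ x h (φ h) := by
  rw [hasDirDeriv_iff_hasDerivAt]
  simpa using ((hasDerivAt_id (0 : ℂ)).mul_const (φ h)).const_add (φ x)

lemma HasDirDeriv.add {f g : E → ℂ} {x h : E} {a b : ℂ} (hf : HasDirDeriv f x h a)
    (hg : HasDirDeriv g x h b) : HasDirDeriv (fun u => f u + g u) x h (a + b) := by
  rw [hasDirDeriv_iff_hasDerivAt] at *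
  exact hf.add hg

lemma HasDirDeriv.mul {f g : E → ℂ} {x h : E} {a b : ℂ} (hf : HasDirDeriv f x h a)
    (hg : HasDirDeriv g x h b) :
    HasDirDeriv (fun u => f u * g u) x h (a * g x + f x * b) := by
  rw [hasDirDeriv_iff_hasDerivAt] at *
  simpa [Pi.mul_def] using hf.mul hg

lemma HasDirDeriv.inv {f : E → ℂ} {x h : E} {a : ℂ} (hf : HasDirDeriv f x h a)
    (hx : f x ≠ 0) : HasDirDeriv (fun u => (f u)⁻¹) x h (-1 * a * ((f x)⁻¹ * (f x)⁻¹)) := by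
  rw [hasDirDeriv_iff_hasDerivAt] at *
  have h0 : f (x + (0 : ℂ) • h) ≠ 0 := by simpa using hx
  refine (hf.fun_inv h0).congr_deriv ?_
  rw [zero_smul, add_zero]
  field_simp

lemma HasDirDeriv.const_mul {f : E → ℂ} {x h : E} {a : ℂ} (c : ℂ) (hf : HasDirDeriv f x h a) :
    HasDirDeriv (fun u => c * f u) x h (c * a) := by
  rw [hasDirDeriv_iff_hasDerivAt] at *
  exact hf.const_mul c

lemma HasDirDeriv.sum {ι : Type*} {s : Finset ι} {f : ι → E → ℂ} {x h : E} {a : ι → ℂ}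
    (hf : ∀ i ∈ s, HasDirDeriv (f i) x h (a i)) :
    HasDirDeriv (fun u => ∑ i ∈ s, f i u) x h (∑ i ∈ s, a i) := by
  simp only [hasDirDeriv_iff_hasDerivAt] at *
  exact HasDerivAt.fun_sum hf

end DirectionalDerivatives

/-! ### Rational functions on a topological vector space -/

section RationalFunctions

/-- `IsRational U f`: on `U`, the function `f` agrees with one obtained from constants and
continuous linear functionals by finitely many sums, products and reciprocals, only functions
without zeros on `U` being inverted. Values outside `U` are irrelevant, by the constructor
`congr`. -/
inductive IsRational {E : Type u} [AddCommGroup E] [Module ℂ E] [TopologicalSpace E]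
    (U : Set E) : (E → ℂ) → Prop
  | const (c : ℂ) : IsRational U fun _ => c
  | linear (φ : E →L[ℂ] ℂ) : IsRational U φ
  | add {f g : E → ℂ} : IsRational U f → IsRational U g → IsRational U fun u => f u + g u
  | mul {f g : E → ℂ} : IsRational U f → IsRational U g → IsRational U fun u => f u * g u
  | inv {f : E → ℂ} : IsRational U f → (∀ u ∈ U, f u ≠ 0) → IsRational U fun u => (f u)⁻¹
  | congr {f g : E → ℂ} : IsRational U f → Set.EqOn f g U → IsRational U g

namespace IsRational

variable {E : Type u} [AddCommGroup E] [Module ℂ E] [TopologicalSpace E] {U : Set E}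

lemma sum {ι : Type*} {s : Finset ι} {f : ι → E → ℂ} (hf : ∀ i ∈ s, IsRational U (f i)) :
    IsRational U fun u => ∑ i ∈ s, f i u := by
  classical
  induction s using Finset.induction_on with
  | empty => simpa using const 0
  | insert i s hi ih =>
    simp only [Finset.sum_insert hi]
    exact (hf i (by simp)).add (ih fun j hj => hf j (by simp [hj]))

lemma pow {f : E → ℂ} (hf : IsRational U f) (n : ℕ) : IsRational U fun u => f u ^ n := by
  induction n with
  | zero => simpa using const 1
  | succ n ih => simpa only [pow_succ] using ih.mul hf

lemma continuousOn {f : E → ℂ} (hf : IsRational U f) : ContinuousOn f U := by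
  induction hf with
  | const c => exact continuousOn_const
  | linear φ => exact φ.continuous.continuousOn
  | add _ _ hf hg => exact hf.add hg
  | mul _ _ hf hg => exact hf.mul hg
  | inv _ h0 hf => exact hf.inv₀ h0
  | congr _ h hf => exact hf.congr h.symm

/-- A rational function of `u` is a rational function of `(u, h)`. -/
lemma comp_fst {f : E → ℂ} (hf : IsRational U f) :
    IsRational (U ×ˢ (Set.univ : Set E)) fun p : E × E => f p.1 := by
  induction hf with
  | const c => exact const c
  | linear φ => exact linear (φ.comp (ContinuousLinearMap.fst ℂ E E))
  | add _ _ hf hg => exact hf.add hg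
  | mul _ _ hf hg => exact hf.mul hg
  | inv _ h0 hf => exact hf.inv fun p hp => h0 _ hp.1
  | congr _ h hf => exact hf.congr fun p hp => h hp.1

/-- Rational functions are stable under differentiation: the derivative `(u, h) ↦ df(u)(h)` is a
rational function on `U × E`. -/
lemma exists_hasDirDeriv [ContinuousAdd E] [ContinuousSMul ℂ E] (hU : IsOpen U) {f : E → ℂ}
    (hf : IsRational U f) : ∃ df : E × E → ℂ,
      (∀ x ∈ U, ∀ h, HasDirDeriv f x h (df (x, h))) ∧
        IsRational (U ×ˢ (Set.univ : Set E)) df := by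
  induction hf with
  | const c =>
    refine ⟨fun _ => 0, fun x _ h => ?_, const 0⟩
    rw [hasDirDeriv_iff_hasDerivAt]
    exact hasDerivAt_const _ _
  | linear φ =>
    exact ⟨fun p => φ p.2, fun x _ h => φ.hasDirDeriv x h,
      linear (φ.comp (ContinuousLinearMap.snd ℂ E E))⟩
  | add _ _ hf hg =>
    obtain ⟨df, hdf, rf⟩ := hf
    obtain ⟨dg, hdg, rg⟩ := hg
    exact ⟨_, fun x hx h => (hdf x hx h).add (hdg x hx h), rf.add rg⟩
  | @mul f g rf' rg' hf hg =>
    obtain ⟨df, hdf, rf⟩ := hf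
    obtain ⟨dg, hdg, rg⟩ := hg
    exact ⟨fun p => df p * g p.1 + f p.1 * dg p, fun x hx h => (hdf x hx h).mul (hdg x hx h),
      (rf.mul rg'.comp_fst).add (rf'.comp_fst.mul rg)⟩
  | @inv f rf' h0 hf =>
    obtain ⟨df, hdf, rf⟩ := hf
    have rinv := rf'.comp_fst.inv fun p hp => h0 _ hp.1
    exact ⟨fun p => -1 * df p * ((f p.1)⁻¹ * (f p.1)⁻¹),
      fun x hx h => (hdf x hx h).inv (h0 x hx), ((const (-1)).mul rf).mul (rinv.mul rinv)⟩
  | congr _ hfg hf =>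
    obtain ⟨df, hdf, rf⟩ := hf
    exact ⟨df, fun x hx h => (hdf x hx h).congr_on hU hfg hx, rf⟩

/-- A map into a product of copies of `ℂ` whose components are all rational is smooth. -/
theorem isSmoothOn_pi [ContinuousAdd E] [ContinuousSMul ℂ E] {ι : Type v} (hU : IsOpen U)
    {f : E → ι → ℂ} (hf : ∀ i, IsRational U fun u => f u i) : IsSmoothOn f U := by
  intro n
  induction n generalizing E with
  | zero => exact continuousOn_pi.2 fun i => (hf i).continuousOn
  | succ n ih =>
    choose df hdf rdf using fun i => (hf i).exists_hasDirDeriv hU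
    refine ⟨continuousOn_pi.2 fun i => (hf i).continuousOn, fun p i => df i p,
      fun x hx h => hasDirDeriv_pi.2 fun i => hdf i x hx h, ?_⟩
    exact ih (hU.prod isOpen_univ) rdf

end IsRational

end RationalFunctions

/-! ### Coefficients of composites -/

section Composites

/-- For `m < N`, only the first `N` coefficients of `g` contribute to the `m`-th coefficient of
`(g ∘ s) w`. -/
lemma PowerSeries.coeff_subst_mul_eq_sum (g w : ℂ⟦X⟧) {s : ℂ⟦X⟧} (hs : constantCoeff s = 0)
    {m N : ℕ} (hm : m < N) :
    coeff m (g.subst s * w) = ∑ k ∈ Finset.range N, coeff k g * coeff m (s ^ k * w) := by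
  have hsub (i : ℕ) (hi : i < N) :
      coeff i (g.subst s) = ∑ k ∈ Finset.range N, coeff k g * coeff i (s ^ k) := by
    rw [coeff_subst' (HasSubst.of_constantCoeff_zero' hs)]
    refine finsum_eq_sum_of_support_subset _ fun k hk => ?_
    by_contra hkN
    refine hk ?_
    have h2 : (X : ℂ⟦X⟧) ^ k ∣ s ^ k := pow_dvd_pow_of_dvd (X_dvd_iff.2 hs) _
    simp only [Finset.coe_range, Set.mem_Iio, not_lt] at hkN
    simp [X_pow_dvd_iff.1 h2 i (by omega)]
  simp only [coeff_mul, Finset.mul_sum]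
  rw [Finset.sum_comm]
  refine Finset.sum_congr rfl fun p hp => ?_
  rw [hsub p.1 (by have := Finset.HasAntidiagonal.mem_antidiagonal.1 hp; omega), Finset.sum_mul]
  exact Finset.sum_congr rfl fun k _ => mul_assoc _ _ _

lemma PowerSeries.coeff_subst_eq_sum (g : ℂ⟦X⟧) {s : ℂ⟦X⟧} (hs : constantCoeff s = 0)
    {m N : ℕ} (hm : m < N) :
    coeff m (g.subst s) = ∑ k ∈ Finset.range N, coeff k g * coeff m (s ^ k) := by
  simpa using coeff_subst_mul_eq_sum g 1 hs hm

variable {E : Type u} [AddCommGroup E] [Module ℂ E]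

lemma HasDirDeriv.coeff_mul {F G : E → ℂ⟦X⟧} {x h : E} {D D' : ℂ⟦X⟧}
    (hF : ∀ m, HasDirDeriv (fun u => coeff m (F u)) x h (coeff m D))
    (hG : ∀ m, HasDirDeriv (fun u => coeff m (G u)) x h (coeff m D')) (m : ℕ) :
    HasDirDeriv (fun u => coeff m (F u * G u)) x h (coeff m (D * G x + F x * D')) := by
  simp only [map_add, PowerSeries.coeff_mul, ← Finset.sum_add_distrib]
  exact HasDirDeriv.sum fun p _ => (hF p.1).mul (hG p.2)

lemma HasDirDeriv.coeff_pow {F : E → ℂ⟦X⟧} {x h : E} {D : ℂ⟦X⟧}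
    (hF : ∀ m, HasDirDeriv (fun u => coeff m (F u)) x h (coeff m D)) (k m : ℕ) :
    HasDirDeriv (fun u => coeff m (F u ^ k)) x h (coeff m (k * F x ^ (k - 1) * D)) := by
  induction k generalizing m with
  | zero =>
    rw [hasDirDeriv_iff_hasDerivAt]
    simpa using hasDerivAt_const (0 : ℂ) (coeff m (1 : ℂ⟦X⟧))
  | succ k ih =>
    have hD : ((k + 1 : ℕ) : ℂ⟦X⟧) * F x ^ (k + 1 - 1) * D =
        (k * F x ^ (k - 1) * D) * F x + F x ^ k * D := by
      cases k with
      | zero => simp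
      | succ k => push_cast; ring
    rw [hD]
    simp only [pow_succ]
    exact HasDirDeriv.coeff_mul ih hF m

/-- The derivative of `s ↦ g ∘ s` in the direction `D` is `(g' ∘ s) D`. -/
theorem HasDirDeriv.coeff_subst (g : ℂ⟦X⟧) {F : E → ℂ⟦X⟧} (hF0 : ∀ u, constantCoeff (F u) = 0)
    {x h : E} {D : ℂ⟦X⟧} (hF : ∀ m, HasDirDeriv (fun u => coeff m (F u)) x h (coeff m D)) (m : ℕ) :
    HasDirDeriv (fun u => coeff m (g.subst (F u))) x h
      (coeff m ((derivative ℂ g).subst (F x) * D)) := by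
  have hm : m < m + 2 := by omega
  have hg (u : E) := coeff_subst_eq_sum g (hF0 u) hm
  suffices hD : coeff m ((derivative ℂ g).subst (F x) * D) =
      ∑ k ∈ Finset.range (m + 2), coeff k g * coeff m ((k : ℂ⟦X⟧) * F x ^ (k - 1) * D) by
    rw [hD]
    simp only [hg]
    exact HasDirDeriv.sum fun k _ => (HasDirDeriv.coeff_pow hF k m).const_mul (coeff k g)
  rw [coeff_subst_mul_eq_sum _ _ (hF0 x) (Nat.lt_succ_self m), Finset.sum_range_succ' _ (m + 1)]
  simp only [Nat.cast_zero, zero_mul, map_zero, mul_zero, add_zero]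
  refine Finset.sum_congr rfl fun k _ => ?_
  rw [coeff_derivative, Nat.add_sub_cancel, mul_assoc ((k + 1 : ℕ) : ℂ⟦X⟧), ← nsmul_eq_mul,
    map_nsmul, nsmul_eq_mul]
  push_cast
  ring

variable [TopologicalSpace E] {U : Set E}

lemma IsRational.coeff_mul {F G : E → ℂ⟦X⟧} (hF : ∀ m, IsRational U fun u => coeff m (F u))
    (hG : ∀ m, IsRational U fun u => coeff m (G u)) (m : ℕ) :
    IsRational U fun u => coeff m (F u * G u) := by
  simp only [PowerSeries.coeff_mul]
  exact IsRational.sum fun p _ => (hF p.1).mul (hG p.2)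

lemma IsRational.coeff_pow {F : E → ℂ⟦X⟧} (hF : ∀ m, IsRational U fun u => coeff m (F u))
    (k m : ℕ) : IsRational U fun u => coeff m (F u ^ k) := by
  induction k generalizing m with
  | zero => simpa using IsRational.const (coeff m (1 : ℂ⟦X⟧))
  | succ k ih =>
    simp only [pow_succ]
    exact IsRational.coeff_mul ih hF m

lemma IsRational.coeff_subst {F G : E → ℂ⟦X⟧} (hF : ∀ m, IsRational U fun u => coeff m (F u))
    (hG : ∀ m, IsRational U fun u => coeff m (G u)) (hG0 : ∀ u, constantCoeff (G u) = 0) (m : ℕ) :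
    IsRational U fun u => coeff m ((F u).subst (G u)) := by
  simp only [fun u => coeff_subst_eq_sum (F u) (hG0 u) (Nat.lt_succ_self m)]
  exact IsRational.sum fun k _ => (hF k).mul (IsRational.coeff_pow hG k m)

/-- The coefficients of a left composition inverse `H` of `F` are rational in those of `F`: the
`m`-th coefficient of `H ∘ F = z` reads `∑ k ≤ m, hₖ [zᵐ] Fᵏ = δ₁ₘ`, where `[zᵐ] Fᵐ` is the `m`-th
power of the leading coefficient of `F`, so that it can be solved for `hₘ`. -/
lemma IsRational.coeff_of_subst_eq_X {F H : E → ℂ⟦X⟧}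
    (hF : ∀ m, IsRational U fun u => coeff m (F u)) (hF0 : ∀ u, constantCoeff (F u) = 0)
    (hF1 : ∀ u ∈ U, coeff 1 (F u) ≠ 0) (hH : ∀ u, (H u).subst (F u) = X) (m : ℕ) :
    IsRational U fun u => coeff m (H u) := by
  induction m using Nat.strong_induction_on with
  | _ m ih =>
    have hsum : IsRational U
        fun u => ∑ k ∈ Finset.range m, coeff k (H u) * coeff m (F u ^ k) :=
      IsRational.sum fun k hk => (ih k (Finset.mem_range.1 hk)).mul (IsRational.coeff_pow hF k m)
    refine (((IsRational.const (coeff m (X : ℂ⟦X⟧))).add ((IsRational.const (-1)).mul hsum)).mul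
      (((hF 1).pow m).inv fun u hu => pow_ne_zero m (hF1 u hu))).congr fun u hu => ?_
    have hlead : coeff m (F u ^ m) = coeff 1 (F u) ^ m := by
      obtain ⟨r, hr⟩ := X_dvd_iff.2 (hF0 u)
      have h1 := coeff_X_pow_mul (r ^ m) m 0
      have h2 := coeff_X_pow_mul r 1 0
      simp only [zero_add, pow_one] at h1 h2
      rw [hr, mul_pow, h1, h2]
      simp
    have key := coeff_subst_eq_sum (H u) (hF0 u) (Nat.lt_succ_self m)
    rw [hH, Finset.sum_range_succ, hlead] at key
    have h1 := pow_ne_zero m (hF1 u hu)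
    simp only
    rw [← div_eq_mul_inv, div_eq_iff h1, key]
    ring

end Composites

/-! ### The Fréchet–Lie group structure -/

section LieGroupStructure

/-- The topology of `ℂ^ℕ` is defined by the seminorms `a ↦ ‖aₙ‖`. -/
lemma isFrechetSpace_pi_nat : IsFrechetSpace (ℕ → ℂ) where
  isUniformAddGroup := inferInstance
  t2Space := inferInstance
  completeSpace := inferInstance
  exists_seminorms :=
    ⟨_, (withSeminorms_pi fun _ : ℕ => norm_withSeminorms ℂ ℂ).congr_equiv
      (Equiv.sigmaUnique ℕ fun _ => Fin 1).symm⟩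

namespace InvertibleSeries

lemma ofCoords_coords (f : InvertibleSeries) : ofCoords (coords f) = f :=
  chart.left_inv (Set.mem_univ f)

lemma coords_ofCoords {a : ℕ → ℂ} (ha : a 0 ≠ 0) : coords (ofCoords a) = a :=
  chart.right_inv ha

lemma isOpen_coords_ne_zero : IsOpen {a : ℕ → ℂ | a 0 ≠ 0} :=
  chart.open_target

lemma isInducing_coords : IsInducing coords :=
  (chart.isOpenEmbedding rfl).isInducing

/-- Every coefficient of `a₁ z + a₂ z² + ⋯` is a continuous linear functional of `(a₁, a₂, …)`. -/
lemma exists_coeff_X_mul_mk (m : ℕ) :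
    ∃ φ : (ℕ → ℂ) →L[ℂ] ℂ, ∀ a : ℕ → ℂ, coeff m (X * PowerSeries.mk a : ℂ⟦X⟧) = φ a := by
  cases m with
  | zero => exact ⟨0, fun a => by simp⟩
  | succ m => exact ⟨ContinuousLinearMap.proj m, fun a => by simp [coeff_succ_X_mul]⟩

section Rational

variable {E : Type u} [AddCommGroup E] [Module ℂ E] [TopologicalSpace E] {U : Set E}

lemma isRational_coeff_series_ofCoords (φ : E →L[ℂ] ℕ → ℂ) (hφ : ∀ u ∈ U, φ u 0 ≠ 0) (m : ℕ) :
    IsRational U fun u => coeff m (ofCoords (φ u)).series := by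
  obtain ⟨ψ, hψ⟩ := exists_coeff_X_mul_mk m
  refine (IsRational.linear (ψ.comp φ)).congr fun u hu => ?_
  rw [series_ofCoords (hφ u hu), hψ]
  rfl

lemma isRational_coords_mul (n : ℕ) :
    IsRational {u : (ℕ → ℂ) × (ℕ → ℂ) | u.1 0 ≠ 0 ∧ u.2 0 ≠ 0}
      fun u => coords (ofCoords u.1 * ofCoords u.2) n := by
  have h1 := isRational_coeff_series_ofCoords (ContinuousLinearMap.fst ℂ (ℕ → ℂ) (ℕ → ℂ))
    (U := {u | u.1 0 ≠ 0 ∧ u.2 0 ≠ 0}) fun _ hu => hu.1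
  have h2 := isRational_coeff_series_ofCoords (ContinuousLinearMap.snd ℂ (ℕ → ℂ) (ℕ → ℂ))
    (U := {u | u.1 0 ≠ 0 ∧ u.2 0 ≠ 0}) fun _ hu => hu.2
  exact IsRational.coeff_subst h1 h2 (fun u => (ofCoords u.2).constantCoeff_series) (n + 1)

lemma isRational_coords_inv (n : ℕ) :
    IsRational {u : ℕ → ℂ | u 0 ≠ 0} fun u => coords (ofCoords u)⁻¹ n :=
  IsRational.coeff_of_subst_eq_X (F := fun u => (ofCoords u).series)
    (isRational_coeff_series_ofCoords (ContinuousLinearMap.id ℂ _) fun _ hu => hu)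
    (fun u => (ofCoords u).constantCoeff_series) (fun u _ => (ofCoords u).coeff_one_series)
    (fun u => congrArg series (inv_mul_cancel (ofCoords u))) (n + 1)

end Rational

lemma isSmoothManifold : IsSmoothManifold (ℕ → ℂ) InvertibleSeries where
  t2Space := (chart.isOpenEmbedding rfl).isEmbedding.t2Space
  smooth_transition := by
    rintro e rfl e' rfl
    have hU : IsOpen (chart.symm ≫ₕ chart).source := (chart.symm ≫ₕ chart).open_source
    refine IsRational.isSmoothOn_pi hU fun n =>
      (IsRational.linear (ContinuousLinearMap.proj n)).congr fun u hu => ?_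
    exact (congrFun (coords_ofCoords hu.1) n).symm

lemma continuous_mul :
    Continuous fun p : InvertibleSeries × InvertibleSeries => p.1 * p.2 := by
  rw [isInducing_coords.continuous_iff]
  have hc : ContinuousOn (fun u : (ℕ → ℂ) × (ℕ → ℂ) => coords (ofCoords u.1 * ofCoords u.2))
      {u | u.1 0 ≠ 0 ∧ u.2 0 ≠ 0} :=
    continuousOn_pi.2 fun n => (isRational_coords_mul n).continuousOn
  have hi := hc.comp_continuous (isInducing_coords.continuous.prodMap isInducing_coords.continuous)
    fun p => ⟨p.1.coeff_one_series, p.2.coeff_one_series⟩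
  exact hi.congr fun p => by simp [ofCoords_coords]

lemma continuous_inv : Continuous fun g : InvertibleSeries => g⁻¹ := by
  rw [isInducing_coords.continuous_iff]
  have hc : ContinuousOn (fun u : ℕ → ℂ => coords (ofCoords u)⁻¹) {u | u 0 ≠ 0} :=
    continuousOn_pi.2 fun n => (isRational_coords_inv n).continuousOn
  have hi := hc.comp_continuous isInducing_coords.continuous fun g => g.coeff_one_series
  exact hi.congr fun g => by simp [ofCoords_coords]

theorem isFrechetLieGroup : IsFrechetLieGroup (ℕ → ℂ) InvertibleSeries where
  isFrechetSpace := isFrechetSpace_pi_nat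
  isSmoothManifold := isSmoothManifold
  smooth_mul := by
    refine ⟨continuous_mul, ?_⟩
    rintro e ⟨e₁, rfl, e₂, rfl, rfl⟩ e' rfl
    have hU : IsOpen {u : (ℕ → ℂ) × (ℕ → ℂ) | u.1 0 ≠ 0 ∧ u.2 0 ≠ 0} :=
      isOpen_coords_ne_zero.prod isOpen_coords_ne_zero
    have h := IsRational.isSmoothOn_pi hU isRational_coords_mul
    rw [← Set.inter_univ {u : (ℕ → ℂ) × (ℕ → ℂ) | _}] at h
    exact h
  smooth_inv := by
    refine ⟨continuous_inv, ?_⟩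
    rintro e rfl e' rfl
    have h := IsRational.isSmoothOn_pi isOpen_coords_ne_zero isRational_coords_inv
    rw [← Set.inter_univ {u : ℕ → ℂ | _}] at h
    exact h

end InvertibleSeries

end LieGroupStructure

/-! ### Left-invariant vector fields -/

section LeftInvariantFields

lemma NonunitSeries.X_mul_mk_coords (f : NonunitSeries) :
    X * PowerSeries.mk (NonunitSeries.coords f) = (f : ℂ⟦X⟧) :=
  congrArg Subtype.val (NonunitSeries.coords.symm_apply_apply f)

namespace InvertibleSeries

lemma hasDirDeriv_coeff_series_ofCoords {a : ℕ → ℂ} (ha : a 0 ≠ 0) (v : ℕ → ℂ) (m : ℕ) :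
    HasDirDeriv (fun u => coeff m (ofCoords u).series) a v (coeff m (X * PowerSeries.mk v)) := by
  obtain ⟨ψ, hψ⟩ := exists_coeff_X_mul_mk m
  rw [hψ]
  refine (ψ.hasDirDeriv a v).congr_on isOpen_coords_ne_zero (fun u hu => ?_) ha
  rw [series_ofCoords hu, hψ]

/-- The tangent map at `x` of the left translation `y ↦ g ∘ y` is multiplication by `g' ∘ x`. -/
lemma tangentMapAt_mul_left (g x : InvertibleSeries) (f : NonunitSeries) (n : ℕ) :
    (tangentMapAt (ℕ → ℂ) (fun y => g * y) x (NonunitSeries.coords f) : ℕ → ℂ) n =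
      coeff (n + 1) ((derivative ℂ g.series).subst x.series * (f : ℂ⟦X⟧)) := by
  have hd : HasDirDeriv (fun u => coords (g * ofCoords u)) (coords x) (NonunitSeries.coords f)
      fun n => coeff (n + 1) ((derivative ℂ g.series).subst x.series * (f : ℂ⟦X⟧)) := by
    refine hasDirDeriv_pi.2 fun n => ?_
    have h := HasDirDeriv.coeff_subst g.series (fun u => (ofCoords u).constantCoeff_series)
      (hasDirDeriv_coeff_series_ofCoords (a := coords x) x.coeff_one_series
        (NonunitSeries.coords f)) (n + 1)
    rwa [ofCoords_coords, NonunitSeries.X_mul_mk_coords] at h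
  exact congrFun hd.dirDeriv_eq n

/-- Since the global chart is used at every point, vector fields are their own coordinate
representations. This also holds outside the image of the chart, where both sides are the value
of `V` at `z`. -/
lemma localRep_chart (V : InvertibleSeries → ℕ → ℂ) (u : ℕ → ℂ) :
    localRep chart V u = V (ofCoords u) := by
  have hd : HasDirDeriv (fun v => coords (ofCoords v)) (coords (ofCoords u)) (V (ofCoords u))
      (V (ofCoords u)) := by
    have hid : HasDirDeriv (fun v : ℕ → ℂ => v) (coords (ofCoords u)) (V (ofCoords u))
        (V (ofCoords u)) :=
      hasDirDeriv_pi.2 fun n =>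
        (ContinuousLinearMap.proj n : (ℕ → ℂ) →L[ℂ] ℂ).hasDirDeriv _ _
    exact hid.congr_on isOpen_coords_ne_zero (fun v hv => (coords_ofCoords hv).symm)
      (ofCoords u).coeff_one_series
  exact hd.dirDeriv_eq

/-- The vector field `Φ_f : g ↦ -g' f`, as a linear function of `f`. -/
def leftInvariantField : NonunitSeries →ₗ[ℂ] InvertibleSeries → ℕ → ℂ where
  toFun f g := -NonunitSeries.coords (NonunitSeries.derivMul g.series f)
  map_add' f h := by
    funext g n
    simp [NonunitSeries.coords, NonunitSeries.derivMul, mul_add, add_comm]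
  map_smul' c f := by
    funext g n
    simp [NonunitSeries.coords, NonunitSeries.derivMul]

lemma leftInvariantField_apply (f : NonunitSeries) (g : InvertibleSeries) :
    leftInvariantField f g = -NonunitSeries.coords (NonunitSeries.derivMul g.series f) := rfl

lemma leftInvariantField_one (f : NonunitSeries) :
    leftInvariantField f 1 = -NonunitSeries.coords f := by
  rw [leftInvariantField_apply]
  congr 2
  refine Subtype.ext ?_
  change derivative ℂ (X : ℂ⟦X⟧) * (f : ℂ⟦X⟧) = f
  simp

lemma leftInvariantField_injective : Function.Injective leftInvariantField := fun f h hfh => by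
  have h1 := congrFun hfh 1
  rw [leftInvariantField_one, leftInvariantField_one, neg_inj] at h1
  exact NonunitSeries.coords.injective h1

/-- Left translating `f ∈ T_z G` to `g` gives `g' f`. -/
lemma tangentMapAt_mul_left_one (g : InvertibleSeries) (f : NonunitSeries) :
    tangentMapAt (ℕ → ℂ) (fun y => g * y) 1 (NonunitSeries.coords f) =
      NonunitSeries.coords (NonunitSeries.derivMul g.series f) := by
  funext n
  rw [tangentMapAt_mul_left]
  change coeff (n + 1) ((derivative ℂ g.series).subst (X : ℂ⟦X⟧) * (f : ℂ⟦X⟧)) = _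
  rw [X_subst]
  rfl

lemma hasDirDeriv_leftInvariantField (f w : NonunitSeries) (g : InvertibleSeries) :
    HasDirDeriv (fun u => leftInvariantField f (ofCoords u)) (coords g) (NonunitSeries.coords w)
      (-NonunitSeries.coords (NonunitSeries.derivMul (w : ℂ⟦X⟧) f)) := by
  refine hasDirDeriv_pi.2 fun n => ?_
  have hs (m : ℕ) : HasDirDeriv (fun u => coeff m (derivative ℂ (ofCoords u).series)) (coords g)
      (NonunitSeries.coords w) (coeff m (derivative ℂ (w : ℂ⟦X⟧))) := by
    have h := (hasDirDeriv_coeff_series_ofCoords (a := coords g) g.coeff_one_series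
      (NonunitSeries.coords w) (m + 1)).const_mul (m + 1 : ℂ)
    rw [NonunitSeries.X_mul_mk_coords] at h
    simpa only [coeff_derivative, mul_comm] using h
  have hf (m : ℕ) : HasDirDeriv (fun _ => coeff m (f : ℂ⟦X⟧)) (coords g)
      (NonunitSeries.coords w) (coeff m (0 : ℂ⟦X⟧)) := by
    rw [hasDirDeriv_iff_hasDerivAt, map_zero]
    exact hasDerivAt_const _ _
  have h := (HasDirDeriv.coeff_mul hs hf (n + 1)).const_mul (-1)
  simp only [neg_one_mul, mul_zero, add_zero] at h
  exact h

lemma isLeftInvariantVectorField_leftInvariantField (f : NonunitSeries) :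
    IsLeftInvariantVectorField (leftInvariantField f) where
  smooth := by
    rintro e rfl
    have hloc : localRep chart (leftInvariantField f) =
        fun u => leftInvariantField f (ofCoords u) := funext (localRep_chart _)
    rw [hloc]
    refine IsRational.isSmoothOn_pi isOpen_coords_ne_zero fun n => ?_
    have hs (m : ℕ) : IsRational {u : ℕ → ℂ | u 0 ≠ 0}
        fun u => coeff m (derivative ℂ (ofCoords u).series) := by
      simp only [coeff_derivative]
      exact (isRational_coeff_series_ofCoords (ContinuousLinearMap.id ℂ _)
        (fun _ hu => hu) (m + 1)).mul (IsRational.const _)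
    have h := (IsRational.const (-1)).mul
      (IsRational.coeff_mul hs (fun m => IsRational.const (coeff m (f : ℂ⟦X⟧))) (n + 1))
    simp only [neg_one_mul] at h
    exact h
  left_invariant g x := by
    funext n
    have hneg : leftInvariantField f x =
        NonunitSeries.coords (-NonunitSeries.derivMul x.series f) := (map_neg _ _).symm
    rw [hneg, tangentMapAt_mul_left]
    change coeff (n + 1) ((derivative ℂ g.series).subst x.series *
        (-(derivative ℂ x.series * (f : ℂ⟦X⟧)))) =
      -coeff (n + 1) (derivative ℂ (g.series.subst x.series) * (f : ℂ⟦X⟧))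
    rw [derivative_subst x.hasSubst, mul_neg, map_neg, mul_assoc]

/-- A left-invariant vector field is determined by its value at `z`. -/
lemma mem_range_leftInvariantField {V : InvertibleSeries → ℕ → ℂ} :
    V ∈ LinearMap.range leftInvariantField ↔ IsLeftInvariantVectorField V := by
  constructor
  · rintro ⟨f, rfl⟩
    exact isLeftInvariantVectorField_leftInvariantField f
  · intro hV
    refine ⟨-NonunitSeries.coords.symm (V 1), funext fun g => ?_⟩
    have h := hV.left_invariant g 1
    rw [← NonunitSeries.coords.apply_symm_apply (V 1), tangentMapAt_mul_left_one, mul_one] at h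
    rw [map_neg, Pi.neg_apply, leftInvariantField_apply, neg_neg, h]

/-- At `g`, the derivative of `Φ_h` in the direction `Φ_f(g) = -g' f` is `(g' f)' h`; the terms
with `g''` cancel in the bracket, and `(g' f)' h - (g' h)' f = -g' (f h' - f' h)` remains. -/
theorem vectorFieldBracket_leftInvariantField (f h : NonunitSeries) :
    vectorFieldBracket (leftInvariantField f) (leftInvariantField h) =
      leftInvariantField ⁅f, h⁆ := by
  have hd (f h : NonunitSeries) (g : InvertibleSeries) :
      dirDeriv (localRep chart (leftInvariantField h)) (coords g) (leftInvariantField f g) =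
        -NonunitSeries.coords
          (NonunitSeries.derivMul (-NonunitSeries.derivMul g.series f : NonunitSeries) h) := by
    have hloc : localRep chart (leftInvariantField h) =
        fun u => leftInvariantField h (ofCoords u) := funext (localRep_chart _)
    have hneg : leftInvariantField f g =
        NonunitSeries.coords (-NonunitSeries.derivMul g.series f) := (map_neg _ _).symm
    rw [hloc, hneg]
    exact (hasDirDeriv_leftInvariantField h _ g).dirDeriv_eq
  funext g
  change dirDeriv (localRep chart (leftInvariantField h)) (coords g) (leftInvariantField f g) -
    dirDeriv (localRep chart (leftInvariantField f)) (coords g) (leftInvariantField h g) = _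
  rw [hd, hd, leftInvariantField_apply, ← map_neg, ← map_neg, ← map_neg, ← map_sub]
  congr 1
  refine Subtype.ext ?_
  change -(derivative ℂ (-(derivative ℂ g.series * (f : ℂ⟦X⟧))) * (h : ℂ⟦X⟧)) -
      -(derivative ℂ (-(derivative ℂ g.series * (h : ℂ⟦X⟧))) * (f : ℂ⟦X⟧)) =
    -(derivative ℂ g.series *
      ((f : ℂ⟦X⟧) * derivative ℂ (h : ℂ⟦X⟧) - derivative ℂ (f : ℂ⟦X⟧) * (h : ℂ⟦X⟧)))
  simp only [map_neg, Derivation.leibniz, smul_eq_mul]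
  ring

end InvertibleSeries

end LeftInvariantFields

end

theorem proposition4p3 :
    IsFrechetLieGroup (ℕ → ℂ) InvertibleSeries ∧
    (∀ f h : NonunitSeries, ((⁅f, h⁆ : NonunitSeries) : PowerSeries ℂ) =
      (f : PowerSeries ℂ) * PowerSeries.derivative ℂ (h : PowerSeries ℂ) -
        PowerSeries.derivative ℂ (f : PowerSeries ℂ) * (h : PowerSeries ℂ)) ∧
    ∃ L : Submodule ℂ (InvertibleSeries → (ℕ → ℂ)),
      (∀ V : InvertibleSeries → (ℕ → ℂ), V ∈ L ↔ IsLeftInvariantVectorField V) ∧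
      ∃ Φ : NonunitSeries ≃ₗ[ℂ] L,
        (∀ f : NonunitSeries,
          (Φ f : InvertibleSeries → (ℕ → ℂ)) 1 = -NonunitSeries.coords f) ∧
        (∀ (f : NonunitSeries) (g : InvertibleSeries),
          (Φ f : InvertibleSeries → (ℕ → ℂ)) g =
            -NonunitSeries.coords (NonunitSeries.derivMul g.series f)) ∧
        (∀ f h : NonunitSeries, (Φ ⁅f, h⁆ : InvertibleSeries → (ℕ → ℂ)) =
          vectorFieldBracket (Φ f : InvertibleSeries → (ℕ → ℂ))
            (Φ h : InvertibleSeries → (ℕ → ℂ))) := by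
  refine ⟨InvertibleSeries.isFrechetLieGroup, NonunitSeries.coe_bracket,
    LinearMap.range InvertibleSeries.leftInvariantField,
    fun V => InvertibleSeries.mem_range_leftInvariantField,
    LinearEquiv.ofInjective _ InvertibleSeries.leftInvariantField_injective,
    InvertibleSeries.leftInvariantField_one, InvertibleSeries.leftInvariantField_apply,
    fun f h => (InvertibleSeries.vectorFieldBracket_leftInvariantField f h).symm⟩
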